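/- A Petri net is a triple $N=(P,T,W)$ with finite disjoint sets $P$ (places) and $T$ (transitions) and a weight function $W\colon (P\times T)\cup(T\times P)\to\mathbb N$. A marking is a map $M\colon P\to\mathbb N$, and a system is a pair $S=(N,M_0)$ with $M_0$ a marking. Write $p^\bullet=\{t\in T: W(p,t)>0\}$ and ${}^\bullet t=\{p\in P: W(p,t)>0\}$, and let $I\in\mathbb Z^{P\times T}$, $I(p,t)=W(t,p)-W(p,t)$, be the incidence matrix. A transition $t$ is enabled at $M$ if $M(p)\ge W(p,t)$ for every $p\in{}^\bullet t$; firing it then leads from $M$ to $M+I[P,t]$, where $I[P,t]$ is the column of $I$ indexed by $t$. Let $R(S)=R((N,M_0))$ be the set of markings obtained from $M_0$ by firing finite (possibly empty) sequences of transitions, and let $$PR(S)=\{M\in\mathbb N^P : \exists\, Y\in\mathbb N^T,\ M=M_0+I\cdot Y\}.$$ The system $S$ is live if for every $t\in T$ and every $M\in R(S)$ some $M'\in R((N,M))$ enables $t$. It is reversible if $M_0\in R((N,M))$ for every $M\in R(S)$. Its reverse is $-S=(-N,M_0)$, where $-N$ is obtained from $N$ by reversing all arcs and keeping their weights. $S$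 satisfies property $\mathcal R$ if both $S$ and $-S$ are reversible. The net $N$ (and the system $S$) is homogeneous free-choice (HFC, also called equal-conflict) if for each place $p$ all weights $W(p,t)$ with $t\in p^\bullet$ are equal, and for every transition $t$ with at least two input places and all $p_1,p_2\in{}^\bullet t$ one has $p_1^\bullet=p_2^\bullet$. **Corollary.** Let $S$ be a system satisfying property $\mathcal R$. If $S$ is live and HFC, then $R(S)=PR(S)$. -/

import Mathlib

/-- A weighted place/transition net with places `P` and transitions `T`. The weight function
`W : (P × T) ∪ (T × P) → ℕ` is given by its two restrictions: `wPT p t` is `W (p, t)` and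
`wTP t p` is `W (t, p)`; the weight `0` means that there is no arc. -/
structure PetriNet (P T : Type*) where
  wPT : P → T → ℕ
  wTP : T → P → ℕ

namespace PetriNet

variable {P T : Type*}

/-- The incidence matrix, `I (p, t) = W (t, p) - W (p, t)`. -/
def incidence (N : PetriNet P T) : Matrix P T ℤ :=
  Matrix.of fun p t => (N.wTP t p : ℤ) - (N.wPT p t : ℤ)

/-- The pre-set of a transition, i.e. its set of input places. -/
def preT (N : PetriNet P T) (t : T) : Set P := {p | 0 < N.wPT p t}

/-- The post-set of a place, i.e. its set of output transitions. -/
def postP (N : PetriNet P T) (p : P) : Set T := {t | 0 < N.wPT p t}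

/-- The reverse net: all arcs are reversed and the weights are kept. -/
def reverse (N : PetriNet P T) : PetriNet P T where
  wPT := fun p t => N.wTP t p
  wTP := fun t p => N.wPT p t

/-- All outgoing weights of each place are equal. -/
def IsHomogeneous (N : PetriNet P T) : Prop :=
  ∀ p : P, ∀ t₁ ∈ N.postP p, ∀ t₂ ∈ N.postP p, N.wPT p t₁ = N.wPT p t₂

/-- A synchronization is a transition with at least two input places. -/
def IsSynchronization (N : PetriNet P T) (t : T) : Prop := (N.preT t).Nontrivial

/-- Free choice: any two input places of a synchronization have the same post-set. -/
def IsFreeChoice (N : PetriNet P T) : Prop :=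
  ∀ t : T, N.IsSynchronization t →
    ∀ p₁ ∈ N.preT t, ∀ p₂ ∈ N.preT t, N.postP p₁ = N.postP p₂

/-- Homogeneous free-choice (equal-conflict) nets. -/
def IsHFC (N : PetriNet P T) : Prop := N.IsHomogeneous ∧ N.IsFreeChoice

/-- The transition `t` is enabled at the marking `M`. -/
def Enabled (N : PetriNet P T) (M : P → ℕ) (t : T) : Prop :=
  ∀ p ∈ N.preT t, N.wPT p t ≤ M p

/-- The step `M [t⟩ M'`: `t` is enabled at `M` and `M' = M + I[P, t]`. -/
def Fires (N : PetriNet P T) (M : P → ℕ) (t : T) (M' : P → ℕ) : Prop :=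
  N.Enabled M t ∧ ∀ p, (M' p : ℤ) = (M p : ℤ) + N.incidence p t

/-- `M [σ⟩ M'` for a finite sequence `σ` of transitions. -/
def FiresSeq (N : PetriNet P T) : (P → ℕ) → List T → (P → ℕ) → Prop
  | M, [], M' => M' = M
  | M, t :: σ, M' => ∃ M₁, N.Fires M t M₁ ∧ N.FiresSeq M₁ σ M'

end PetriNet

/-- A Petri net system: a net with an initial marking. -/
structure PetriSystem (P T : Type*) where
  net : PetriNet P T
  init : P → ℕ

namespace PetriSystem

variable {P T : Type*}

/-- `R(S)`: the set of markings reachable from the initial marking. -/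
def reachable (S : PetriSystem P T) : Set (P → ℕ) :=
  {M | ∃ σ : List T, S.net.FiresSeq S.init σ M}

/-- `PR(S)`: the set of potentially reachable markings, i.e. the markings `M` such that the state
equation `M = M₀ + I · Y` has a solution `Y` in non-negative integers. -/
def potentiallyReachable [Fintype T] (S : PetriSystem P T) : Set (P → ℕ) :=
  {M | ∃ Y : T → ℕ, (fun p => (M p : ℤ)) =
    (fun p => (S.init p : ℤ)) + S.net.incidence.mulVec (fun t => (Y t : ℤ))}

/-- The reverse system: the net is reversed and the initial marking is kept. -/
def reverse (S : PetriSystem P T) : PetriSystem P T := ⟨S.net.reverse, S.init⟩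

/-- `S` is live: for each transition `t` and each reachable marking `M`, some marking reachable
from `M` enables `t`. -/
def IsLive (S : PetriSystem P T) : Prop :=
  ∀ t : T, ∀ M ∈ S.reachable, ∃ M' ∈ reachable ⟨S.net, M⟩, S.net.Enabled M' t

/-- `H` is a home state of `S`: it can be reached from every reachable marking. -/
def IsHomeState (S : PetriSystem P T) (H : P → ℕ) : Prop :=
  ∀ M ∈ S.reachable, H ∈ reachable ⟨S.net, M⟩

/-- `S` is reversible: its initial marking is a home state. -/
def IsReversible (S : PetriSystem P T) : Prop := S.IsHomeState S.init

/-- The property `R`: both the system and its reverse are reversible. -/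
def PropertyR (S : PetriSystem P T) : Prop := S.IsReversible ∧ S.reverse.IsReversible

end PetriSystem

namespace PetriNet

variable {P T : Type*}

/-! Let M = M₀ + I·Y. Liveness and HFC give M₀ and M a common successor C, by induction on the total
of Y. Follow from M₀ a run enabling some transition in the support of Y, stopping once any such
transition is enabled. Each v fired before that shares no input place with the support, by HFC, so M
can fire v too and Y is unchanged. Firing the enabled support transition from the M₀ side alone then
shrinks Y. Reversibility of S gives M → C → M₀, a run M₀ → M of -S; reversibility of -S returns it
as a run M → M₀ of -S, i.e. M₀ → M in S. -/

/-- Some transition leads from `M` to `M'`. -/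
def Step (N : PetriNet P T) (M M' : P → ℕ) : Prop := ∃ t, N.Fires M t M'

theorem exists_firesSeq_iff (N : PetriNet P T) {M M' : P → ℕ} :
    (∃ σ, N.FiresSeq M σ M') ↔ Relation.ReflTransGen N.Step M M' := by
  constructor
  · rintro ⟨σ, h⟩
    induction σ generalizing M with
    | nil => rw [show M' = M from h]
    | cons t σ ih =>
      obtain ⟨M₁, h₁, h₂⟩ := h
      exact (ih h₂).head ⟨t, h₁⟩
  · intro h
    induction h using Relation.ReflTransGen.head_induction_on with
    | refl => exact ⟨[], rfl⟩
    | head h _ ih =>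
      obtain ⟨t, ht⟩ := h
      obtain ⟨σ, hσ⟩ := ih
      exact ⟨t :: σ, _, ht, hσ⟩

theorem enabled_iff (N : PetriNet P T) {M : P → ℕ} {t : T} :
    N.Enabled M t ↔ ∀ p, N.wPT p t ≤ M p :=
  ⟨fun h p => (Nat.eq_zero_or_pos (N.wPT p t)).elim (fun h0 => h0 ▸ Nat.zero_le _) (h p),
    fun h p _ => h p⟩

theorem Enabled.fires {N : PetriNet P T} {M : P → ℕ} {t : T} (h : N.Enabled M t) :
    -- The natural subtraction never truncates, since `t` is enabled.
    N.Fires M t (fun p => M p + N.wTP t p - N.wPT p t) := by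
  refine ⟨h, fun p => ?_⟩
  have := N.enabled_iff.1 h p
  simp only [incidence, Matrix.of_apply]
  omega

theorem Fires.reverse {N : PetriNet P T} {M M' : P → ℕ} {t : T} (h : N.Fires M t M') :
    N.reverse.Fires M' t M := by
  obtain ⟨he, hM⟩ := h
  rw [enabled_iff] at he
  simp only [incidence, Matrix.of_apply] at hM
  refine ⟨N.reverse.enabled_iff.2 fun p => ?_, fun p => ?_⟩ <;>
    have h₁ := he p <;> have h₂ := hM p <;>
    simp only [PetriNet.reverse, incidence, Matrix.of_apply] <;> omega

theorem reflTransGen_step_reverse {N : PetriNet P T} {M M' : P → ℕ}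
    (h : Relation.ReflTransGen N.Step M M') : Relation.ReflTransGen N.reverse.Step M' M := by
  induction h with
  | refl => exact .refl
  | tail _ hs ih =>
    obtain ⟨t, ht⟩ := hs
    exact ih.head ⟨t, ht.reverse⟩

/-- Transitions of a homogeneous free-choice net that share an input place are enabled at the
same markings. -/
theorem IsHFC.enabled_of_enabled {N : PetriNet P T} (hN : N.IsHFC) {M : P → ℕ} {t u : T} {p : P}
    (ht : 0 < N.wPT p t) (hu : 0 < N.wPT p u) (h : N.Enabled M t) : N.Enabled M u := by
  intro q hq
  have htq : t ∈ N.postP q := by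
    -- If `p ≠ q`, then `u` is a synchronization, so free choice equates the post-sets of `p` and
    -- `q`.
    by_cases hpq : p = q
    · exact hpq ▸ ht
    · exact hN.2 u ⟨p, hu, q, hq, hpq⟩ p hu q hq ▸ ht
  rw [hN.1 q u hq t htq]
  exact h q htq

variable [Fintype T]

/-- `M = A + I · Y`. -/
def StateEq (N : PetriNet P T) (A : P → ℕ) (Y : T → ℕ) (M : P → ℕ) : Prop :=
  ∀ p, (M p : ℤ) = A p + ∑ t, N.incidence p t * Y t

theorem StateEq.fires {N : PetriNet P T} {A A' M M' : P → ℕ} {Y : T → ℕ} {t : T}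
    (h : N.StateEq A Y M) (hA : N.Fires A t A') (hM : N.Fires M t M') : N.StateEq A' Y M' :=
  fun p => by rw [hA.2, hM.2, h p]; ring

theorem StateEq.fires_left {N : PetriNet P T} {A A' M : P → ℕ} {Y : T → ℕ} {t : T}
    (h : N.StateEq A Y M) (hA : N.Fires A t A') (ht : 0 < Y t) :
    ∃ Y', ∑ u, Y u = ∑ u, Y' u + 1 ∧ N.StateEq A' Y' M := by
  classical
  obtain ⟨Y', rfl⟩ : ∃ Y' : T → ℕ, Y = Pi.single t 1 + Y' := by
    refine exists_add_of_le (Pi.le_def.2 fun u => ?_)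
    by_cases hu : u = t
    · subst hu; simpa using Nat.succ_le_of_lt ht
    · simp [hu]
  refine ⟨Y', by simp [Finset.sum_add_distrib, add_comm], fun p => ?_⟩
  rw [h p, hA.2]
  simp [Finset.sum_add_distrib, mul_add, Pi.single_apply, add_assoc]

/-- If a transition of the support of `Y` can be enabled from `A`, then `A` and `A + I · Y` can
be moved in parallel until one is. -/
theorem IsHFC.exists_enabled_of_stateEq {N : PetriNet P T} (hN : N.IsHFC) {A B M : P → ℕ}
    {Y : T → ℕ} {t : T} (ht : 0 < Y t) (hB : N.Enabled B t)
    (hAB : Relation.ReflTransGen N.Step A B) (h : N.StateEq A Y M) :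
    ∃ A' M', Relation.ReflTransGen N.Step A A' ∧ Relation.ReflTransGen N.Step M M' ∧
      N.StateEq A' Y M' ∧ ∃ u, 0 < Y u ∧ N.Enabled A' u := by
  induction hAB using Relation.ReflTransGen.head_induction_on generalizing M with
  | refl => exact ⟨B, M, .refl, .refl, h, t, ht, hB⟩
  | @head A A₁ hs _ ih =>
    by_cases hen : ∃ u, 0 < Y u ∧ N.Enabled A u
    · exact ⟨A, M, .refl, .refl, h, hen⟩
    obtain ⟨v, hv⟩ := hs
    -- No support transition consumes from an input place `p` of `v`: otherwise it would be enabled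
    -- along with `v`. Hence `A p ≤ M p` there.
    have hMv : N.Enabled M v := by
      intro p hp
      have hsum : 0 ≤ ∑ u, N.incidence p u * Y u := by
        refine Finset.sum_nonneg fun u _ => ?_
        rcases Nat.eq_zero_or_pos (Y u) with hu | hu
        · simp [hu]
        · have h0 : N.wPT p u = 0 := by
            by_contra hne
            exact hen ⟨u, hu, hN.enabled_of_enabled hp (Nat.pos_of_ne_zero hne) hv.1⟩
          simp only [incidence, Matrix.of_apply, h0, Nat.cast_zero, sub_zero]
          positivity
      have := hv.1 p hp
      have := h p
      omega
    obtain ⟨A', M', hA, hM, hst, hu⟩ := ih (h.fires hv hMv.fires)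
    exact ⟨A', M', hA.head ⟨v, hv⟩, hM.head ⟨v, hMv.fires⟩, hst, hu⟩

/-- In a live homogeneous free-choice system, a marking has a common successor with every
solution of its state equation. -/
theorem IsHFC.join_of_stateEq {N : PetriNet P T} (hN : N.IsHFC) {A M : P → ℕ} {Y : T → ℕ}
    (hlive : ∀ t B, Relation.ReflTransGen N.Step A B →
      ∃ B', Relation.ReflTransGen N.Step B B' ∧ N.Enabled B' t)
    (h : N.StateEq A Y M) : Relation.Join (Relation.ReflTransGen N.Step) A M := by
  induction hn : ∑ u, Y u generalizing A M Y with
  | zero =>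
    have hMA : M = A := by
      funext p
      have := h p
      simp_all
    exact ⟨A, .refl, hMA ▸ .refl⟩
  | succ n ih =>
    obtain ⟨t, -, ht⟩ : ∃ t ∈ Finset.univ, 0 < Y t := by
      rw [← Finset.sum_pos_iff]; omega
    obtain ⟨B, hAB, hB⟩ := hlive t A .refl
    obtain ⟨A', M', hA, hM, hst, u, hu, hen⟩ := hN.exists_enabled_of_stateEq ht hB hAB h
    obtain ⟨Y', hsum, hst'⟩ := hst.fires_left hen.fires hu
    have hA' := hA.tail ⟨u, hen.fires⟩
    obtain ⟨C, hC, hC'⟩ := ih (fun t B hB => hlive t B (hA'.trans hB)) hst' (by omega)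
    exact ⟨C, hA'.trans hC, hM.trans hC'⟩

theorem stateEq_of_reflTransGen {N : PetriNet P T} {A M : P → ℕ}
    (h : Relation.ReflTransGen N.Step A M) : ∃ Y, N.StateEq A Y M := by
  classical
  induction h with
  | refl => exact ⟨0, fun p => by simp⟩
  | tail _ hs ih =>
    obtain ⟨Y, hY⟩ := ih
    obtain ⟨t, ht⟩ := hs
    refine ⟨Y + Pi.single t 1, fun p => ?_⟩
    rw [ht.2, hY p]
    simp [Finset.sum_add_distrib, mul_add, Pi.single_apply, add_assoc]

end PetriNet

namespace PetriSystem

variable {P T : Type*}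

theorem mem_reachable_iff {S : PetriSystem P T} {M : P → ℕ} :
    M ∈ S.reachable ↔ Relation.ReflTransGen S.net.Step S.init M :=
  S.net.exists_firesSeq_iff

theorem mem_potentiallyReachable_iff [Fintype T] {S : PetriSystem P T} {M : P → ℕ} :
    M ∈ S.potentiallyReachable ↔ ∃ Y, S.net.StateEq S.init Y M :=
  exists_congr fun _ => funext_iff

end PetriSystem

theorem mainTheorem8 {P T : Type*} [Fintype P] [Fintype T] (S : PetriSystem P T)
    (hR : S.PropertyR) (hLive : S.IsLive) (hHFC : S.net.IsHFC) :
    S.reachable = S.potentiallyReachable := by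
  ext M
  rw [PetriSystem.mem_reachable_iff, PetriSystem.mem_potentiallyReachable_iff]
  refine ⟨PetriNet.stateEq_of_reflTransGen, fun ⟨Y, hY⟩ => ?_⟩
  obtain ⟨C, hC, hMC⟩ := hHFC.join_of_stateEq (fun t B hB => by
    obtain ⟨B', hB', hen⟩ := hLive t B (PetriSystem.mem_reachable_iff.2 hB)
    exact ⟨B', PetriSystem.mem_reachable_iff.1 hB', hen⟩) hY
  -- Only `C` is known to be reachable, so reversibility of `S` applies to it, not to `M`.
  have hback : Relation.ReflTransGen S.net.Step C S.init :=
    PetriSystem.mem_reachable_iff.1 (hR.1 C (PetriSystem.mem_reachable_iff.2 hC))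
  have hM : M ∈ S.reverse.reachable :=
    PetriSystem.mem_reachable_iff.2 (PetriNet.reflTransGen_step_reverse (hMC.trans hback))
  exact PetriNet.reflTransGen_step_reverse (PetriSystem.mem_reachable_iff.1 (hR.2 M hM))
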